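/- Let $N\ge 1$ be an integer, $\mathbb Z_N=\mathbb Z/N\mathbb Z$, let $b=(b_1,b_2,b_3)\in\mathbb R^3$, and let $v=(v_n)_{n\in\mathbb Z}\in\ell^\infty(\mathbb Z)$ be a bounded real sequence. Let $\ell^2(\Gamma)$ be the Hilbert space of square-summable complex functions $f=(f_\omega)$ on the vertex set $\mathbb Z\times\{0,1\}\times\mathbb Z_N$ of the armchair nanotube $\Gamma$. The tight-binding magnetic Hamiltonian $H^b=H^b_0+V$ is the bounded operator on $\ell^2(\Gamma)$ given by $$(H_0^bf)_{n,0,k}=e^{ib_2}f_{n+1,1,k}+e^{ib_1}f_{n-1,1,k-1}+e^{ib_3}f_{n,1,k},$$ $$(H_0^bf)_{n,1,k}=e^{-ib_1}f_{n+1,0,k+1}+e^{-ib_2}f_{n-1,0,k}+e^{-ib_3}f_{n,0,k},$$ $$(Vf)_{n,0,k}=v_{2n}f_{n,0,k},\qquad (Vf)_{n,1,k}=v_{2n+1}f_{n,1,k}.$$ Then $H^b$ is unitarily equivalent to the orthogonal sum $\bigoplus_{k=1}^N J_k^b$, where $J_k^b$ is the Jacobi operator acting on $\ell^2(\mathbb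 Z)\oplus\ell^2(\mathbb Z)$ (whose elements are viewed as sequences $y=(y_n)_{n\in\mathbb Z}$ in $\mathbb C^2$) by $$(J_k^by)_n=a_k\,y_{n-1}+a_k^*\,y_{n+1}+d_n\,y_n,\qquad n\in\mathbb Z,$$ $$a_k=\begin{pmatrix}0&e^{ib_1}s^k\\ e^{-ib_2}&0\end{pmatrix},\qquad s=e^{2\pi i/N},\qquad d_n=\begin{pmatrix}v_{2n}&e^{ib_3}\\ e^{-ib_3}&v_{2n+1}\end{pmatrix}.$$ If, moreover, the potential $v$ is periodic (that is, $v_{n+p}=v_n$ for all $n\in\mathbb Z$ and some integer $p\ge1$), then each $J_k^b$, $1\le k\le N$, is self-adjoint with purely absolutely continuous spectrum: for every $x\in\ell^2(\mathbb Z)\oplus\ell^2(\mathbb Z)$ the spectral measure of $J_k^b$ at $x$ is absolutely continuous with respect to Lebesgue measure. -/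

import Mathlib

open scoped ENNReal Matrix

noncomputable section

namespace ArmchairNanotube

/-! ### The Hilbert spaces -/

/-- The Hilbert space `ℓ²(ι)` of square summable complex functions on `ι`. -/
abbrev L2 (ι : Type*) : Type _ := lp (fun _ : ι => ℂ) 2

/-- The index set `ℤ × {0,1} × ℤ_N` of the vertices of the armchair nanotube. -/
abbrev Vertex (N : ℕ) : Type := ℤ × Fin 2 × ZMod N

/-- The Hilbert space `ℓ²(ℤ) ⊕ ℓ²(ℤ)`. -/
abbrev L2Pair : Type := WithLp 2 (L2 ℤ × L2 ℤ)

/-- The `n`-th entry `y_n ∈ ℂ²` of `y ∈ ℓ²(ℤ) ⊕ ℓ²(ℤ)`. -/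
def entry (y : L2Pair) (n : ℤ) : Fin 2 → ℂ := ![y.fst n, y.snd n]

/-- Bounded real sequences, the space `ℓ^∞` of the potentials. -/
abbrev Potential : Type := lp (fun _ : ℤ => ℝ) ∞

/-! ### Elementary bounded operators on `ℓ²`, used to see that the formulas below define
bounded operators -/

/-- Multiplication of a function in `ℓ²(ι)` by a bounded weight, composed with a permutation. -/
theorem exists_weighted {ι : Type*} (σ : Equiv.Perm ι) (w : ι → ℂ) (C : ℝ)
    (hw : ∀ i, ‖w i‖ ≤ C) :
    ∃ T : L2 ι →L[ℂ] L2 ι, ∀ f i, T f i = w i * f (σ i) := by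
  have hC : ∀ i, ‖w i‖ ^ 2 ≤ C ^ 2 := fun i => pow_le_pow_left₀ (norm_nonneg _) (hw i) 2
  have hs : ∀ f : L2 ι, Summable fun i => ‖f i‖ ^ 2 := fun f => by
    simpa using (lp.memℓp f).summable (by norm_num)
  have hsσ : ∀ f : L2 ι, Summable fun i => C ^ 2 * ‖f (σ i)‖ ^ 2 := fun f =>
    ((σ.summable_iff (f := fun i => ‖f i‖ ^ 2)).2 (hs f)).mul_left _
  have hle : ∀ (f : L2 ι) i, ‖w i * f (σ i)‖ ^ 2 ≤ C ^ 2 * ‖f (σ i)‖ ^ 2 := fun f i => by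
    rw [norm_mul, mul_pow]
    exact mul_le_mul_of_nonneg_right (hC i) (by positivity)
  have hsw : ∀ f : L2 ι, Summable fun i => ‖w i * f (σ i)‖ ^ 2 := fun f =>
    Summable.of_nonneg_of_le (fun i => by positivity) (hle f) (hsσ f)
  have hmem : ∀ f : L2 ι, Memℓp (fun i => w i * f (σ i)) 2 := fun f => by
    apply memℓp_gen
    simpa using hsw f
  have hn : ∀ f : L2 ι, ‖f‖ ^ 2 = ∑' i, ‖f i‖ ^ 2 := fun f => by
    simpa using lp.norm_rpow_eq_tsum (p := 2) (by norm_num) f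
  let L : L2 ι →ₗ[ℂ] L2 ι :=
    { toFun := fun f => ⟨fun i => w i * f (σ i), hmem f⟩
      map_add' := fun f g => by ext i; exact mul_add _ _ _
      map_smul' := fun c f => by ext i; exact mul_left_comm _ _ _ }
  refine ⟨L.mkContinuous |C| fun f => ?_, fun f i => rfl⟩
  refine le_of_sq_le_sq ?_ (by positivity)
  rw [mul_pow, sq_abs, hn, hn]
  calc ∑' i, ‖L f i‖ ^ 2 ≤ ∑' i, C ^ 2 * ‖f (σ i)‖ ^ 2 := (hsw f).tsum_le_tsum (hle f) (hsσ f)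
    _ = C ^ 2 * ∑' i, ‖f i‖ ^ 2 := by
      rw [tsum_mul_left, σ.tsum_eq (fun i => ‖f i‖ ^ 2)]

/-! ### The magnetic Hamiltonian of the armchair nanotube -/

/-- The expression `H^b f = H₀^b f + V f`, where
`(H₀^b f)_{n,0,k} = e^{ib₂} f_{n+1,1,k} + e^{ib₁} f_{n-1,1,k-1} + e^{ib₃} f_{n,1,k}`,
`(H₀^b f)_{n,1,k} = e^{-ib₁} f_{n+1,0,k+1} + e^{-ib₂} f_{n-1,0,k} + e^{-ib₃} f_{n,0,k}`,
and `V` is multiplication by `V_{n,0,k} = v_{2n}`, `V_{n,1,k} = v_{2n+1}`. -/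
def hamiltonianFormula {N : ℕ} (b₁ b₂ b₃ : ℝ) (v : ℤ → ℝ) (f : Vertex N → ℂ) : Vertex N → ℂ
  | (n, 0, k) =>
      Complex.exp (Complex.I * b₂) * f (n + 1, 1, k)
        + Complex.exp (Complex.I * b₁) * f (n - 1, 1, k - 1)
        + Complex.exp (Complex.I * b₃) * f (n, 1, k)
        + v (2 * n) * f (n, 0, k)
  | (n, 1, k) =>
      Complex.exp (-(Complex.I * b₁)) * f (n + 1, 0, k + 1)
        + Complex.exp (-(Complex.I * b₂)) * f (n - 1, 0, k)
        + Complex.exp (-(Complex.I * b₃)) * f (n, 0, k)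
        + v (2 * n + 1) * f (n, 1, k)

/-- The involution of the vertices that exchanges `(n,0,k)` and `(n+m,1,k+l)`. -/
def bond (N : ℕ) (m : ℤ) (l : ZMod N) : Equiv.Perm (Vertex N) :=
  Function.Involutive.toPerm
    (fun ω => if ω.2.1 = 0 then (ω.1 + m, 1, ω.2.2 + l) else (ω.1 - m, 0, ω.2.2 - l))
    (by
      rintro ⟨n, j, k⟩
      fin_cases j <;> simp)

theorem exists_hamiltonian (N : ℕ) (b₁ b₂ b₃ : ℝ) (v : Potential) :
    ∃ T : L2 (Vertex N) →L[ℂ] L2 (Vertex N),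
      ∀ f, ⇑(T f) = hamiltonianFormula b₁ b₂ b₃ v f := by
  have hop : ∀ (m : ℤ) (l : ZMod N) (b : ℝ), ∃ T : L2 (Vertex N) →L[ℂ] L2 (Vertex N),
      ∀ f ω, T f ω = (if ω.2.1 = 0 then Complex.exp (Complex.I * b)
        else Complex.exp (-(Complex.I * b))) * f (bond N m l ω) := fun m l b =>
    exists_weighted (bond N m l) _ 1 fun ω => by
      split_ifs <;> simp [Complex.norm_exp]
  obtain ⟨T₁, h₁⟩ := hop (-1) (-1) b₁
  obtain ⟨T₂, h₂⟩ := hop 1 0 b₂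
  obtain ⟨T₃, h₃⟩ := hop 0 0 b₃
  obtain ⟨T₄, h₄⟩ := exists_weighted (Equiv.refl (Vertex N))
    (fun ω => if ω.2.1 = 0 then (v (2 * ω.1) : ℂ) else (v (2 * ω.1 + 1) : ℂ)) ‖v‖ fun ω => by
      split_ifs <;> rw [Complex.norm_real] <;> exact lp.norm_apply_le_norm (by simp) v _
  refine ⟨T₂ + T₁ + T₃ + T₄, fun f => ?_⟩
  ext ⟨n, j, k⟩
  have h : (T₂ + T₁ + T₃ + T₄) f (n, j, k)
      = T₂ f (n, j, k) + T₁ f (n, j, k) + T₃ f (n, j, k) + T₄ f (n, j, k) := rfl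
  rw [h, h₁, h₂, h₃, h₄]
  fin_cases j
  · simp [hamiltonianFormula, bond, sub_eq_add_neg]
  · simp [hamiltonianFormula, bond]
    ring

/-- The tight-binding Hamiltonian `H^b = H₀^b + V`, `b = (b₁,b₂,b₃)`, as a bounded operator
on `ℓ²(Γ)`. -/
def hamiltonian (N : ℕ) (b₁ b₂ b₃ : ℝ) (v : Potential) :
    L2 (Vertex N) →L[ℂ] L2 (Vertex N) :=
  LinearMap.mkContinuousOfExistsBound
    { toFun := fun f => ⟨hamiltonianFormula b₁ b₂ b₃ v f, by
        obtain ⟨T, hT⟩ := exists_hamiltonian N b₁ b₂ b₃ v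
        rw [← hT]
        exact lp.memℓp (T f)⟩
      map_add' := fun f g => by
        ext ⟨n, j, k⟩
        change hamiltonianFormula b₁ b₂ b₃ v (f + g) (n, j, k) =
          hamiltonianFormula b₁ b₂ b₃ v f (n, j, k) + hamiltonianFormula b₁ b₂ b₃ v g (n, j, k)
        fin_cases j <;> simp [hamiltonianFormula] <;> ring
      map_smul' := fun c f => by
        ext ⟨n, j, k⟩
        fin_cases j <;> simp [hamiltonianFormula] <;> ring }
    (by
      obtain ⟨T, hT⟩ := exists_hamiltonian N b₁ b₂ b₃ v
      refine ⟨‖T‖, fun f => ?_⟩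
      have h : (⟨hamiltonianFormula b₁ b₂ b₃ v f, by
          rw [← hT]; exact lp.memℓp (T f)⟩ : L2 (Vertex N)) = T f := lp.ext (hT f).symm
      change ‖(⟨hamiltonianFormula b₁ b₂ b₃ v f, _⟩ : L2 (Vertex N))‖ ≤ _
      rw [h]
      exact T.le_opNorm f)

theorem hamiltonian_apply (N : ℕ) (b₁ b₂ b₃ : ℝ) (v : Potential) (f : L2 (Vertex N)) :
    ⇑(hamiltonian N b₁ b₂ b₃ v f) = hamiltonianFormula b₁ b₂ b₃ v f := rfl

/-! ### The Jacobi operators with `2 × 2` matrix coefficients -/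

/-- The off-diagonal coefficient `a_k`, with `s = e^{2πi/N}`. -/
def offDiag (N : ℕ) (b₁ b₂ : ℝ) (k : ℕ) : Matrix (Fin 2) (Fin 2) ℂ :=
  !![0, Complex.exp (Complex.I * b₁) * Complex.exp (2 * Real.pi * Complex.I / N) ^ k;
    Complex.exp (-(Complex.I * b₂)), 0]

/-- The diagonal coefficients `d_n`. -/
def diag (b₃ : ℝ) (v : ℤ → ℝ) (n : ℤ) : Matrix (Fin 2) (Fin 2) ℂ :=
  !![(v (2 * n) : ℂ), Complex.exp (Complex.I * b₃);
    Complex.exp (-(Complex.I * b₃)), (v (2 * n + 1) : ℂ)]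

/-- The expression `a y_{n-1} + a^* y_{n+1} + d_n y_n` for a sequence `y` in `ℂ²`. -/
def jacobiFormula (a : Matrix (Fin 2) (Fin 2) ℂ) (d : ℤ → Matrix (Fin 2) (Fin 2) ℂ)
    (y : ℤ → Fin 2 → ℂ) (n : ℤ) : Fin 2 → ℂ :=
  a *ᵥ y (n - 1) + aᴴ *ᵥ y (n + 1) + d n *ᵥ y n

theorem exists_scalarJacobi (α β : ℂ) (w : ℤ → ℂ) (C : ℝ) (hw : ∀ n, ‖w n‖ ≤ C) :
    ∃ T : L2 ℤ →L[ℂ] L2 ℤ, ∀ f n, T f n = α * f (n - 1) + β * f (n + 1) + w n * f n := by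
  obtain ⟨T₁, h₁⟩ := exists_weighted (Equiv.subRight (1 : ℤ)) (fun _ => α) ‖α‖ fun _ => le_rfl
  obtain ⟨T₂, h₂⟩ := exists_weighted (Equiv.addRight (1 : ℤ)) (fun _ => β) ‖β‖ fun _ => le_rfl
  obtain ⟨T₃, h₃⟩ := exists_weighted (Equiv.refl ℤ) w C hw
  refine ⟨T₁ + T₂ + T₃, fun f n => ?_⟩
  have h : (T₁ + T₂ + T₃) f n = T₁ f n + T₂ f n + T₃ f n := rfl
  rw [h, h₁, h₂, h₃]
  rfl

theorem exists_jacobi (a : Matrix (Fin 2) (Fin 2) ℂ) (d : ℤ → Matrix (Fin 2) (Fin 2) ℂ)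
    (hd : ∃ C : ℝ, ∀ n i j, ‖d n i j‖ ≤ C) :
    ∃ T : L2Pair →L[ℂ] L2Pair, ∀ y n, entry (T y) n = jacobiFormula a d (entry y) n := by
  obtain ⟨C, hC⟩ := hd
  have hb : ∀ i j, ∃ T : L2 ℤ →L[ℂ] L2 ℤ, ∀ f n,
      T f n = a i j * f (n - 1) + star (a j i) * f (n + 1) + d n i j * f n := fun i j =>
    exists_scalarJacobi (a i j) (star (a j i)) (fun n => d n i j) C fun n => hC n i j
  choose B hB using hb
  let e := WithLp.prodContinuousLinearEquiv 2 ℂ (L2 ℤ) (L2 ℤ)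
  let M : L2 ℤ × L2 ℤ →L[ℂ] L2 ℤ × L2 ℤ :=
    ((B 0 0).coprod (B 0 1)).prod ((B 1 0).coprod (B 1 1))
  refine ⟨(e.symm : _ →L[ℂ] L2Pair) ∘L M ∘L (e : L2Pair →L[ℂ] _), fun y n => ?_⟩
  have h0 : entry (((e.symm : _ →L[ℂ] L2Pair) ∘L M ∘L (e : L2Pair →L[ℂ] _)) y) n
      = ![B 0 0 y.fst n + B 0 1 y.snd n, B 1 0 y.fst n + B 1 1 y.snd n] := rfl
  rw [h0, hB, hB, hB, hB]
  ext i
  fin_cases i <;>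
    simp [jacobiFormula, entry,
      Matrix.conjTranspose_apply] <;> ring

/-- The Jacobi operator `(J y)_n = a y_{n-1} + a^* y_{n+1} + d_n y_n` on `ℓ²(ℤ) ⊕ ℓ²(ℤ)`, for a
`2 × 2` matrix `a` and a bounded sequence `d` of `2 × 2` matrices: the bounded operator with this
action, which is unique by `jacobi_unique`. -/
def jacobi (a : Matrix (Fin 2) (Fin 2) ℂ) (d : ℤ → Matrix (Fin 2) (Fin 2) ℂ)
    (hd : ∃ C : ℝ, ∀ n i j, ‖d n i j‖ ≤ C) : L2Pair →L[ℂ] L2Pair :=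
  (exists_jacobi a d hd).choose

theorem entry_jacobi (a : Matrix (Fin 2) (Fin 2) ℂ) (d : ℤ → Matrix (Fin 2) (Fin 2) ℂ)
    (hd : ∃ C : ℝ, ∀ n i j, ‖d n i j‖ ≤ C) (y : L2Pair) (n : ℤ) :
    entry (jacobi a d hd y) n = a *ᵥ entry y (n - 1) + aᴴ *ᵥ entry y (n + 1) + d n *ᵥ entry y n :=
  (exists_jacobi a d hd).choose_spec y n

theorem entry_ext {x y : L2Pair} (h : ∀ n, entry x n = entry y n) : x = y := by
  have h0 : x.fst = y.fst := lp.ext (funext fun n => congrFun (h n) 0)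
  have h1 : x.snd = y.snd := lp.ext (funext fun n => congrFun (h n) 1)
  exact WithLp.ofLp_injective 2 (Prod.ext h0 h1)

theorem jacobi_unique (a : Matrix (Fin 2) (Fin 2) ℂ) (d : ℤ → Matrix (Fin 2) (Fin 2) ℂ)
    (hd : ∃ C : ℝ, ∀ n i j, ‖d n i j‖ ≤ C) (T : L2Pair →L[ℂ] L2Pair)
    (hT : ∀ y n, entry (T y) n = a *ᵥ entry y (n - 1) + aᴴ *ᵥ entry y (n + 1) + d n *ᵥ entry y n) :
    T = jacobi a d hd :=
  ContinuousLinearMap.ext fun y => entry_ext fun n => by rw [hT, entry_jacobi]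

theorem diag_bounded (b₃ : ℝ) (v : Potential) :
    ∃ C : ℝ, ∀ n i j, ‖diag b₃ v n i j‖ ≤ C := by
  refine ⟨max 1 ‖v‖, fun n i j => ?_⟩
  have hv : ∀ m, |v m| ≤ ‖v‖ := fun m => lp.norm_apply_le_norm (by simp) v m
  fin_cases i <;> fin_cases j <;> simp [diag, Complex.norm_exp, hv]

/-- The Jacobi operator `J_k^b` on `ℓ²(ℤ) ⊕ ℓ²(ℤ)`. -/
def armchairJacobi (N : ℕ) (b₁ b₂ b₃ : ℝ) (v : Potential) (k : ℕ) : L2Pair →L[ℂ] L2Pair :=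
  jacobi (offDiag N b₁ b₂ k) (diag b₃ v) (diag_bounded b₃ v)

/-! ### Orthogonal sums, unitary equivalence, absolutely continuous spectrum -/

/-- The orthogonal sum of bounded operators, `(y_k)_k ↦ (T_k y_k)_k` on the Hilbert space
direct sum. -/
def orthogonalSum {κ : Type*} [Fintype κ] {E : κ → Type*} [∀ k, NormedAddCommGroup (E k)]
    [∀ k, InnerProductSpace ℂ (E k)] (T : ∀ k, E k →L[ℂ] E k) :
    PiLp 2 E →L[ℂ] PiLp 2 E :=
  ((PiLp.continuousLinearEquiv 2 ℂ E).symm : (∀ k, E k) →L[ℂ] PiLp 2 E) ∘L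
    ContinuousLinearMap.piMap T ∘L
    (PiLp.continuousLinearEquiv 2 ℂ E : PiLp 2 E →L[ℂ] ∀ k, E k)

theorem orthogonalSum_apply {κ : Type*} [Fintype κ] {E : κ → Type*}
    [∀ k, NormedAddCommGroup (E k)] [∀ k, InnerProductSpace ℂ (E k)]
    (T : ∀ k, E k →L[ℂ] E k) (y : PiLp 2 E) (k : κ) : orthogonalSum T y k = T k (y k) := rfl

/-- Bounded operators `S` on `E` and `T` on `F` are unitarily equivalent. -/
def UnitarilyEquivalent {E F : Type*} [NormedAddCommGroup E] [InnerProductSpace ℂ E]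
    [NormedAddCommGroup F] [InnerProductSpace ℂ F] (S : E →L[ℂ] E) (T : F →L[ℂ] F) : Prop :=
  ∃ U : E ≃ₗᵢ[ℂ] F, ∀ x, U (S x) = T (U x)

/-- `μ` is the spectral measure of the self-adjoint bounded operator `T` at the vector `x`:
`⟨x, f(T) x⟩ = ∫ f dμ` for all continuous `f`, where `f(T)` is given by the continuous functional
calculus. -/
def IsSpectralMeasure {E : Type*} [NormedAddCommGroup E] [InnerProductSpace ℂ E]
    [CompleteSpace E] (T : E →L[ℂ] E) (x : E) (μ : MeasureTheory.Measure ℝ) : Prop :=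
  MeasureTheory.IsFiniteMeasure μ ∧
    ∀ f : ℝ → ℝ, Continuous f → inner ℂ x (cfc f T x) = ((∫ t, f t ∂μ : ℝ) : ℂ)

/-- The bounded operator `T` is self-adjoint and has (purely) absolutely continuous spectrum: the
spectral measures of all vectors are absolutely continuous with respect to Lebesgue measure. -/
def HasAbsolutelyContinuousSpectrum {E : Type*} [NormedAddCommGroup E] [InnerProductSpace ℂ E]
    [CompleteSpace E] (T : E →L[ℂ] E) : Prop :=
  IsSelfAdjoint T ∧ ∀ x : E, ∃ μ : MeasureTheory.Measure ℝ,
    IsSpectralMeasure T x μ ∧ MeasureTheory.Measure.AbsolutelyContinuous μ MeasureTheory.volume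

end ArmchairNanotube

end

namespace ArmchairNanotube

open MeasureTheory Topology Filter

/-! ### Null sets on level curves -/

/-! Unitary equivalence. The Hamiltonian commutes with rotations of the tube, so the discrete
Fourier transform in the angular variable splits it: its `k`-th component turns the shifts `j ∓ 1`
into multiplication by `s ^ k` and its conjugate (`angularFourier_hamiltonian`). Orthogonality of
characters makes the transform unitary.

Absolute continuity. For a potential of period `p`, the powers of a Jacobi operator have matrix
elements that are averages over a quasimomentum `t` of entries of powers of a Hermitian matrix `A t
= e^{-it} S + e^{it} Sᴴ + D` of size `2p` (`entry_jacobi_pow_basisVec`). These moments suffice;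
neither a direct integral nor eigenvalue branches are constructed.

Since `a_k` is invertible, so is `S`. With `w = e^{it}`, the polynomial `det (w (A t - l))` in `w`
has the value `det S ≠ 0` at `w = 0`, hence vanishes identically for no `l`: there are no flat
bands. Its zeros on the circle then locally depend on `l` in a Lipschitz way, after differentiating
in `w` at multiple zeros. So for a null set `K` of energies, almost no `A t` has an eigenvalue in
`K` (`ae_forall_det_ne_zero`).

Continuous bumps shrinking to a compact null set `K` therefore have `g(A t) → 0` for almost all `t`,
and dominated convergence gives `g(J) x → 0` for each basis vector `x`
(`tendsto_cfc_bump_of_moments`), hence for all `x` by density. So spectral measures do not charge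
compact null sets, and inner regularity gives absolute continuity. -/

/-- At two zeros of `F`, strict differentiability makes `F' (p - q)` small against `p - q`, so the
second coordinate is controlled by the first. The derivative into `ℂ` need not be surjective, and
only this half of the implicit function theorem is needed. -/
theorem exists_nhds_lipschitz_of_hasStrictFDerivAt {F : ℝ × ℝ → ℂ} {F' : ℝ × ℝ →L[ℝ] ℂ}
    {z : ℝ × ℝ} (hF : HasStrictFDerivAt F F' z) (hz : F' (0, 1) ≠ 0) :
    ∃ U ∈ 𝓝 z, ∃ K : ℝ, 0 ≤ K ∧ ∀ p ∈ U, ∀ q ∈ U, F p = 0 → F q = 0 →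
      |p.2 - q.2| ≤ K * |p.1 - q.1| := by
  set k : ℝ := ‖F' (0, 1)‖ with hk
  have hk0 : 0 < k := norm_pos_iff.2 hz
  -- With the constant `k / 2`, half of `k * |p.2 - q.2|` can be absorbed into the left side.
  have h := hF.isLittleO.def (half_pos hk0)
  rw [nhds_prod_eq, Filter.eventually_prod_self_iff'] at h
  obtain ⟨U, hU, h⟩ := h
  refine ⟨U, hU, 2 * ‖F' (1, 0)‖ / k + 1, by positivity, fun p hp q hq hFp hFq => ?_⟩
  have h1 := h p hp q hq
  rw [hFp, hFq, sub_zero, zero_sub, norm_neg] at h1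
  have h2 : p - q = (p.1 - q.1) • ((1 : ℝ), (0 : ℝ)) + (p.2 - q.2) • ((0 : ℝ), (1 : ℝ)) := by
    ext <;> simp
  have h3 : ‖p - q‖ ≤ |p.1 - q.1| + |p.2 - q.2| := by
    rw [Prod.norm_def]
    exact max_le (le_add_of_nonneg_right (abs_nonneg _)) (le_add_of_nonneg_left (abs_nonneg _))
  have h4 : |p.2 - q.2| * k ≤ ‖F' (p - q)‖ + |p.1 - q.1| * ‖F' (1, 0)‖ := by
    have : (p.2 - q.2) • F' (0, 1) = F' (p - q) - (p.1 - q.1) • F' (1, 0) := by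
      rw [h2, map_add, map_smul, map_smul]; simp
    calc |p.2 - q.2| * k = ‖(p.2 - q.2) • F' (0, 1)‖ := by rw [norm_smul, Real.norm_eq_abs]
      _ ≤ ‖F' (p - q)‖ + ‖(p.1 - q.1) • F' (1, 0)‖ := by rw [this]; exact norm_sub_le _ _
      _ = _ := by rw [norm_smul, Real.norm_eq_abs]
  have h5 : |p.2 - q.2| * k ≤ (2 * ‖F' (1, 0)‖ + k) * |p.1 - q.1| := by
    have := mul_le_mul_of_nonneg_left h3 (half_pos hk0).le
    nlinarith
  rw [div_add_one hk0.ne', div_mul_eq_mul_div, le_div_iff₀ hk0]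
  exact h5

/-- If `E` is a null set and `∂F/∂θ ≠ 0` on a subset `S` of `{F = 0} ∩ (E × ℝ)`, then the
projection of `S` to the second coordinate is a null set. -/
theorem volume_image_snd_eq_zero {F : ℝ × ℝ → ℂ} {E : Set ℝ} (hE : volume E = 0)
    {S : Set (ℝ × ℝ)} (hSE : ∀ z ∈ S, z.1 ∈ E) (hF0 : ∀ z ∈ S, F z = 0)
    (hF : ∀ z ∈ S, ∃ F' : ℝ × ℝ →L[ℝ] ℂ, HasStrictFDerivAt F F' z ∧ F' (0, 1) ≠ 0) :
    volume (Prod.snd '' S) = 0 := by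
  -- The measure of the projection is an outer measure on the plane, so its vanishing on `S` may be
  -- checked locally.
  let m : OuterMeasure (ℝ × ℝ) := OuterMeasure.comap Prod.snd (volume : Measure ℝ).toOuterMeasure
  change m S = 0
  refine measure_null_of_locally_null S fun z hz => ?_
  obtain ⟨F', hF', hne⟩ := hF z hz
  obtain ⟨U, hU, K, hK, hL⟩ := exists_nhds_lipschitz_of_hasStrictFDerivAt hF' hne
  refine ⟨U ∩ S, inter_mem (mem_nhdsWithin_of_mem_nhds hU) self_mem_nhdsWithin, ?_⟩
  change volume (Prod.snd '' (U ∩ S)) = 0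
  have hL' : ∀ p ∈ U ∩ S, ∀ q ∈ U ∩ S, |p.2 - q.2| ≤ K * |p.1 - q.1| := fun p hp q hq =>
    hL p hp.1 q hq.1 (hF0 p hp.2) (hF0 q hq.2)
  -- Locally `S` is the graph of a Lipschitz function `g` over its first projection; elsewhere the
  -- value of `g` is irrelevant.
  have hg : ∀ x : ℝ, ∃ y : ℝ, ∀ p ∈ U ∩ S, p.1 = x → p.2 = y := fun x => by
    by_cases hx : ∃ q ∈ U ∩ S, q.1 = x
    · obtain ⟨q, hq, rfl⟩ := hx
      refine ⟨q.2, fun p hp hpq => ?_⟩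
      have := hL' p hp q hq
      rw [hpq, sub_self, abs_zero, mul_zero] at this
      exact sub_eq_zero.1 (abs_eq_zero.1 (this.antisymm (abs_nonneg _)))
    · exact ⟨0, fun p hp hpx => absurd ⟨p, hp, hpx⟩ hx⟩
  choose g hg using hg
  have himg : Prod.snd '' (U ∩ S) = g '' (Prod.fst '' (U ∩ S)) := by
    rw [Set.image_image]
    exact Set.image_congr fun p hp => hg p.1 p hp rfl
  have hLip : LipschitzOnWith ⟨K, hK⟩ g (Prod.fst '' (U ∩ S)) := by
    refine LipschitzOnWith.of_dist_le_mul ?_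
    rintro _ ⟨p, hp, rfl⟩ _ ⟨q, hq, rfl⟩
    rw [← hg p.1 p hp rfl, ← hg q.1 q hq rfl]
    exact hL' p hp q hq
  have hnull : volume (Prod.fst '' (U ∩ S)) = 0 :=
    measure_mono_null (by rintro _ ⟨p, hp, rfl⟩; exact hSE p hp.2) hE
  rw [himg, ← hausdorffMeasure_real]
  refine le_antisymm ((hLip.hausdorffMeasure_image_le zero_le_one).trans ?_) zero_le
  rw [hausdorffMeasure_real, hnull, mul_zero]

/-! ### Bivariate polynomials along the unit circle -/

open Polynomial

theorem contDiff_evalEval (P : ℂ[X][X]) :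
    ContDiff ℝ 1 fun z : ℝ × ℝ => P.evalEval (z.1 : ℂ) (Complex.exp (z.2 * Complex.I)) := by
  have h1 : ContDiff ℝ 1 fun z : ℝ × ℝ => (z.1 : ℂ) :=
    Complex.ofRealCLM.contDiff.comp contDiff_fst
  have h2 : ContDiff ℝ 1 fun z : ℝ × ℝ => Complex.exp (z.2 * Complex.I) :=
    ((Complex.ofRealCLM.contDiff.comp contDiff_snd).mul contDiff_const).cexp
  have h3 : ∀ a : ℂ[X], ContDiff ℝ 1 fun z : ℝ × ℝ => a.eval (z.1 : ℂ) := fun a => by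
    induction a using Polynomial.induction_on' with
    | add p q hp hq => simpa using hp.add hq
    | monomial n c => simpa using contDiff_const.mul (h1.pow n)
  induction P using Polynomial.induction_on' with
  | add p q hp hq => simpa [evalEval_add] using hp.add hq
  | monomial n a => 
    simpa [evalEval, ← C_mul_X_pow_eq_monomial] using (h3 a).mul (h2.pow n)

theorem hasDerivAt_evalEval (P : ℂ[X][X]) (l t : ℝ) :
    HasDerivAt (fun s : ℝ => P.evalEval (l : ℂ) (Complex.exp (s * Complex.I)))
      ((derivative P).evalEval (l : ℂ) (Complex.exp (t * Complex.I)) *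
        (Complex.exp (t * Complex.I) * Complex.I)) t := by
  have h : HasDerivAt (fun s : ℝ => Complex.exp (s * Complex.I))
      (Complex.exp (t * Complex.I) * Complex.I) t := by
    simpa using ((Complex.ofRealCLM.hasDerivAt (x := t)).mul_const Complex.I).cexp
  have h2 := ((P.map (evalRingHom (l : ℂ))).hasDerivAt (Complex.exp (t * Complex.I))).comp t h
  simpa only [Function.comp_def, derivative_map, eval_map, eval₂_evalRingHom] using h2

theorem exists_iterate_derivative_eval_ne_zero {q : ℂ[X]} (hq : q ≠ 0) (w : ℂ) :
    ∃ m, (derivative^[m] q).eval w ≠ 0 := by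
  by_contra! h
  have := Polynomial.lt_rootMultiplicity_iff_isRoot_iterate_derivative hq (t := w)
    (n := q.rootMultiplicity w)
  exact lt_irrefl _ (this.2 fun m _ => h m)

/-- If no `P(λ, ·)` vanishes identically, then for `λ` in a null set the zeros of `P(λ, ·)` on the
unit circle form a null set. -/
theorem volume_setOf_exists_evalEval_eq_zero (P : ℂ[X][X])
    (hP : ∀ l : ℂ, P.map (evalRingHom l) ≠ 0) {E : Set ℝ} (hE : volume E = 0) :
    volume {t : ℝ | ∃ l ∈ E, P.evalEval (l : ℂ) (Complex.exp (t * Complex.I)) = 0} = 0 := by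
  let F : ℕ → ℝ × ℝ → ℂ := fun m z =>
    (derivative^[m] P).evalEval (z.1 : ℂ) (Complex.exp (z.2 * Complex.I))
  -- Zeros are stratified so that on each stratum some `w`-derivative of `P` has a simple zero in
  -- `w`.
  let S : ℕ → Set (ℝ × ℝ) := fun m => {z | z.1 ∈ E ∧ F m z = 0 ∧ F (m + 1) z ≠ 0}
  have hS : ∀ m, volume (Prod.snd '' S m) = 0 := fun m => by
    refine volume_image_snd_eq_zero (F := F m) hE (fun z hz => hz.1) (fun z hz => hz.2.1) ?_
    rintro ⟨l, t⟩ ⟨-, -, hz⟩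
    have hstrict := (contDiff_evalEval (derivative^[m] P)).contDiffAt.hasStrictFDerivAt
      (x := (l, t)) one_ne_zero
    refine ⟨_, hstrict, ?_⟩
    have h1 : HasDerivAt (fun s : ℝ => (l, s)) ((0 : ℝ), (1 : ℝ)) t :=
      (hasDerivAt_const t l).prodMk (hasDerivAt_id t)
    have h2 := hstrict.hasFDerivAt.comp_hasDerivAt t h1
    have h3 := h2.unique (hasDerivAt_evalEval (derivative^[m] P) l t)
    rw [h3]
    refine mul_ne_zero ?_ (mul_ne_zero (Complex.exp_ne_zero _) Complex.I_ne_zero)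
    simpa [F, Function.iterate_succ_apply'] using hz
  refine measure_mono_null ?_ (measure_iUnion_null hS)
  rintro t ⟨l, hl, h0⟩
  obtain ⟨m, hm⟩ := exists_iterate_derivative_eval_ne_zero (hP l) (Complex.exp (t * Complex.I))
  have hF : ∃ m, F m (l, t) ≠ 0 := by
    refine ⟨m, ?_⟩
    rwa [iterate_derivative_map, eval_map, eval₂_evalRingHom] at hm
  classical
  -- The first nonvanishing derivative is not the zeroth, so the one before it has a simple zero at
  -- `(l, t)`.
  have hn0 : Nat.find hF ≠ 0 := fun h => Nat.find_spec hF (by rw [h]; exact h0)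
  obtain ⟨n, hn⟩ := Nat.exists_eq_succ_of_ne_zero hn0
  refine Set.mem_iUnion.2 ⟨n, (l, t), ⟨hl, ?_, ?_⟩, rfl⟩
  · exact not_not.1 (Nat.find_min hF (m := n) (by omega))
  · have := Nat.find_spec hF
    rwa [hn] at this

/-- For a matrix pencil `e^{-iθ} A + e^{iθ} B + D` with invertible `A`, almost no `θ` has an
eigenvalue in a given null set. -/
theorem ae_forall_det_ne_zero {ι : Type*} [Fintype ι] [DecidableEq ι] (A B D : Matrix ι ι ℂ)
    (hA : A.det ≠ 0) {E : Set ℝ} (hE : volume E = 0) :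
    ∀ᵐ t : ℝ, ∀ l ∈ E, (Complex.exp (-(t * Complex.I)) • A + Complex.exp (t * Complex.I) • B + D
      - (l : ℂ) • (1 : Matrix ι ι ℂ)).det ≠ 0 := by
  -- The pencil minus `λ`, multiplied by `w = e^{iθ}` to clear the negative power; the inner
  -- variable is `λ`, the outer one `w`.
  let M : Matrix ι ι ℂ[X][X] :=
    A.map (fun c => C (C c)) + (X ^ 2 : ℂ[X][X]) • B.map (fun c => C (C c))
    + (X : ℂ[X][X]) • (D.map (fun c => C (C c)) - (C X : ℂ[X][X]) • (1 : Matrix ι ι ℂ[X][X]))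
  have hM : ∀ l w : ℂ, M.det.evalEval l w
      = (A + w ^ 2 • B + w • (D - l • (1 : Matrix ι ι ℂ))).det := fun l w => by
    rw [← coe_evalEvalRingHom, RingHom.map_det]
    congr 1
    ext i j
    by_cases hij : i = j <;> simp [M, hij] <;> ring
  have hP : ∀ l : ℂ, M.det.map (evalRingHom l) ≠ 0 := fun l h => by
    have h0 := hM l 0
    rw [← eval₂_evalRingHom, ← eval_map, h] at h0
    simp at h0
    exact hA h0.symm
  have := volume_setOf_exists_evalEval_eq_zero M.det hP hE
  rw [ae_iff]
  refine measure_mono_null ?_ this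
  intro t ht
  simp only [Set.mem_ofPred_eq, not_forall, not_not] at ht ⊢
  obtain ⟨l, hl, h⟩ := ht
  refine ⟨l, hl, ?_⟩
  rw [hM]
  set w := Complex.exp (t * Complex.I) with hw
  have hw0 : w ≠ 0 := Complex.exp_ne_zero _
  rw [Complex.exp_neg, ← hw] at h
  have : A + w ^ 2 • B + w • (D - (l : ℂ) • (1 : Matrix ι ι ℂ))
      = w • (w⁻¹ • A + w • B + D - (l : ℂ) • (1 : Matrix ι ι ℂ)) := by
    rw [add_sub_assoc, smul_add, smul_add, smul_smul, smul_smul, mul_inv_cancel₀ hw0, one_smul, sq]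
  rw [this, Matrix.det_smul, h, mul_zero]

/-! ### Spectral measures -/

section SpectralMeasure

variable {E : Type*} [NormedAddCommGroup E] [InnerProductSpace ℂ E] [CompleteSpace E]

/-- Riesz–Markov–Kakutani for the positive functional `f ↦ Re ⟨x, f(T) x⟩` on the compact spectrum,
pushed forward to `ℝ`. -/
theorem exists_isSpectralMeasure {T : E →L[ℂ] E} (hT : IsSelfAdjoint T) (x : E) :
    ∃ μ : Measure ℝ, IsSpectralMeasure T x μ := by
  let Λ : CompactlySupportedContinuousMap (spectrum ℝ T) ℝ →ₚ[ℝ] ℝ := PositiveLinearMap.mk₀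
    { toFun := fun f => (inner ℂ x (cfcHom hT f.toContinuousMap x)).re
      map_add' := fun f g => by
        have : (f + g).toContinuousMap = f.toContinuousMap + g.toContinuousMap := rfl
        simp [this]
      map_smul' := fun c f => by
        have : (c • f).toContinuousMap = c • f.toContinuousMap := rfl
        rw [this, map_smul]
        simp [inner_smul_right_eq_smul] }
    (fun f hf => by
      have h : (0 : E →L[ℂ] E) ≤ cfcHom hT f.toContinuousMap :=
        (cfcHom_nonneg_iff hT).2 fun t => hf t
      exact ((ContinuousLinearMap.nonneg_iff_isPositive _).1 h).re_inner_nonneg_right x)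
  have : CompactSpace (spectrum ℝ T) := isCompact_iff_compactSpace.1
    (ContinuousFunctionalCalculus.isCompact_spectrum T)
  refine ⟨(RealRMK.rieszMeasure Λ).map Subtype.val, ?_, fun f hf => ?_⟩
  · exact Measure.isFiniteMeasure_map _ _
  · rw [integral_map measurable_subtype_coe.aemeasurable hf.aestronglyMeasurable]
    let g : C(spectrum ℝ T, ℝ) := ⟨(spectrum ℝ T).domRestrict f, hf.continuousOn.domRestrict⟩
    have h1 := RealRMK.integral_rieszMeasure Λ
      (CompactlySupportedContinuousMap.continuousMapEquiv g)
    have h2 : cfc f T = cfcHom hT g := cfc_apply f T hT hf.continuousOn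
    have h3 : ∫ t : spectrum ℝ T, f t ∂(RealRMK.rieszMeasure Λ) = (inner ℂ x (cfc f T x)).re := by
      rw [h2]; exact h1
    rw [h3]
    have hs : IsSelfAdjoint (cfc f T) := cfc_predicate f T
    refine Complex.ext rfl ?_
    rw [Complex.ofReal_im, ← Complex.conj_eq_iff_im, inner_conj_symm]
    exact hs.isSymmetric x x

/-- The piecewise linear function with value `1` on `K` and `0` outside of the
`1 / (m + 1)`-neighborhood of `K`. -/
noncomputable def bump (K : Set ℝ) (m : ℕ) (t : ℝ) : ℝ := max 0 (1 - (m + 1) * Metric.infDist t K)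

theorem continuous_bump (K : Set ℝ) (m : ℕ) : Continuous (bump K m) :=
  continuous_const.max (continuous_const.sub
    (continuous_const.mul (Metric.continuous_infDist_pt K)))

theorem bump_nonneg (K : Set ℝ) (m : ℕ) (t : ℝ) : 0 ≤ bump K m t := le_max_left _ _

theorem bump_le_one (K : Set ℝ) (m : ℕ) (t : ℝ) : bump K m t ≤ 1 :=
  max_le zero_le_one (sub_le_self _ (mul_nonneg (by positivity) Metric.infDist_nonneg))

theorem bump_of_mem {K : Set ℝ} {t : ℝ} (ht : t ∈ K) (m : ℕ) : bump K m t = 1 := by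
  simp [bump, Metric.infDist_zero_of_mem ht]

theorem bump_eq_zero {K : Set ℝ} {t : ℝ} {m : ℕ} (h : 1 ≤ (m + 1) * Metric.infDist t K) :
    bump K m t = 0 := max_eq_left (sub_nonpos.2 h)

theorem norm_cfc_bump_le {T : E →L[ℂ] E} (K : Set ℝ) (m : ℕ) : ‖cfc (bump K m) T‖ ≤ 1 :=
  norm_cfc_le zero_le_one fun t _ => by
    rw [Real.norm_of_nonneg (bump_nonneg K m t)]; exact bump_le_one K m t

/-- Self-adjointness of `bump(T)` moves one factor across; squaring the bump thus turns quadratic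
forms into norms, hence weak statements into strong convergence. -/
theorem inner_cfc_sq_bump {T : E →L[ℂ] E} (K : Set ℝ) (m : ℕ) (x : E) :
    inner ℂ x (cfc (fun t => bump K m t ^ 2) T x) = ((‖cfc (bump K m) T x‖ ^ 2 : ℝ) : ℂ) := by
  have h : cfc (fun t => bump K m t ^ 2) T = cfc (bump K m) T * cfc (bump K m) T := by
    rw [← cfc_mul _ _ _ (continuous_bump K m).continuousOn (continuous_bump K m).continuousOn]
    simp_rw [sq]
  have hs : IsSelfAdjoint (cfc (bump K m) T) := cfc_predicate _ T
  rw [h, mul_apply_eq_comp, Complex.ofReal_pow]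
  have h2 : inner ℂ (cfc (bump K m) T x) (cfc (bump K m) T x)
      = (‖cfc (bump K m) T x‖ : ℂ) ^ 2 := inner_self_eq_norm_sq_to_K _
  rw [← h2]
  exact (hs.isSymmetric x _).symm

/-- A null set charged by `μ` would contain a charged compact `K`, whereas `μ K ≤ ∫ bump² dμ =
‖bump(T) x‖² → 0`. -/
theorem IsSpectralMeasure.absolutelyContinuous {T : E →L[ℂ] E} {x : E} {μ : Measure ℝ}
    (hμ : IsSpectralMeasure T x μ)
    (h : ∀ K : Set ℝ, K.Nonempty → IsCompact K → volume K = 0 →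
      Tendsto (fun m => cfc (bump K m) T x) atTop (𝓝 0)) : μ ≪ volume := by
  obtain ⟨hfin, hint⟩ := hμ
  refine Measure.AbsolutelyContinuous.mk fun s hs h0 => ?_
  by_contra hne
  obtain ⟨K, hKs, hK, hμK⟩ := hs.exists_lt_isCompact (pos_iff_ne_zero.2 hne)
  have hKne : K.Nonempty := by
    rw [Set.nonempty_iff_ne_empty]; rintro rfl; simp at hμK
  have hlim := h K hKne hK (measure_mono_null hKs h0)
  have hlim2 : Tendsto (fun m => ‖cfc (bump K m) T x‖ ^ 2) atTop (𝓝 0) := by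
    simpa using hlim.norm.pow 2
  have hle : ∀ m, μ.real K ≤ ‖cfc (bump K m) T x‖ ^ 2 := fun m => by
    have h1 := hint (fun t => bump K m t ^ 2) ((continuous_bump K m).pow 2)
    rw [inner_cfc_sq_bump] at h1
    rw [Complex.ofReal_injective h1, ← integral_indicator_one hK.measurableSet]
    refine integral_mono ((integrable_const (1 : ℝ)).indicator hK.measurableSet) ?_ fun t => ?_
    · refine Integrable.of_bound ((continuous_bump K m).pow 2).aestronglyMeasurable 1
        (Eventually.of_forall fun t => ?_)
      rw [norm_pow, Real.norm_of_nonneg (bump_nonneg K m t)]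
      exact pow_le_one₀ (bump_nonneg K m t) (bump_le_one K m t)
    · by_cases ht : t ∈ K
      · simp [ht, bump_of_mem ht]
      · simpa [ht] using sq_nonneg (bump K m t)
  have h2 : μ.real K ≤ 0 := ge_of_tendsto' hlim2 hle
  exact h2.not_gt (ENNReal.toReal_pos hμK.ne' (measure_ne_top μ K))

/-- The vectors on which a sequence of contractions tends to zero strongly form a closed
subspace. -/
theorem tendsto_zero_of_dense_span {E : Type*} [NormedAddCommGroup E] [InnerProductSpace ℂ E]
    {G : ℕ → E →L[ℂ] E} (hG : ∀ m, ‖G m‖ ≤ 1) {s : Set E}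
    (hs : Dense (Submodule.span ℂ s : Set E))
    (h : ∀ x ∈ s, Tendsto (fun m => G m x) atTop (𝓝 0)) (x : E) :
    Tendsto (fun m => G m x) atTop (𝓝 0) := by
  have hspan : ∀ y ∈ Submodule.span ℂ s, Tendsto (fun m => G m y) atTop (𝓝 0) := fun y hy => by
    induction hy using Submodule.span_induction with
    | mem y hy => exact h y hy
    | zero => simp
    | add y z _ _ hy hz => simpa using hy.add hz
    | smul c y _ hy => simpa using hy.const_smul c
  rw [Metric.tendsto_atTop]
  intro ε hε
  obtain ⟨y, hy, hxy⟩ := Metric.mem_closure_iff.1 (hs x) (ε / 2) (half_pos hε)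
  obtain ⟨n, hn⟩ := Metric.tendsto_atTop.1 (hspan y hy) (ε / 2) (half_pos hε)
  refine ⟨n, fun m hm => ?_⟩
  have h1 := hn m hm
  rw [dist_zero_right] at h1 ⊢
  have h2 : ‖G m (x - y)‖ ≤ ‖x - y‖ := by
    simpa using (G m).le_of_opNorm_le (hG m) (x - y)
  rw [dist_eq_norm] at hxy
  have h3 : G m x = G m (x - y) + G m y := by simp
  rw [h3]
  exact (norm_add_le _ _).trans_lt (by linarith)

theorem hasAbsolutelyContinuousSpectrum_of_dense_span {T : E →L[ℂ] E} (hT : IsSelfAdjoint T)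
    {s : Set E} (hs : Dense (Submodule.span ℂ s : Set E))
    (h : ∀ K : Set ℝ, K.Nonempty → IsCompact K → volume K = 0 →
      ∀ x ∈ s, Tendsto (fun m => cfc (bump K m) T x) atTop (𝓝 0)) :
    HasAbsolutelyContinuousSpectrum T := by
  refine ⟨hT, fun x => ?_⟩
  obtain ⟨μ, hμ⟩ := exists_isSpectralMeasure hT x
  exact ⟨μ, hμ, hμ.absolutelyContinuous fun K hKne hK h0 =>
    tendsto_zero_of_dense_span (norm_cfc_bump_le K) hs (h K hKne hK h0) x⟩

end SpectralMeasure

/-! ### Direct integrals -/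

section DirectIntegral

variable {E : Type*} [NormedAddCommGroup E] [InnerProductSpace ℂ E] [CompleteSpace E]
  {𝒜 : Type*} [CStarAlgebra 𝒜]

open Polynomial

theorem continuous_aeval_comp {A : ℝ → 𝒜} (hA : Continuous A) (q : ℝ[X]) :
    Continuous fun t => aeval (A t) q :=
  (Polynomial.continuous_aeval q).comp hA

theorem inner_aeval_eq_integral {E : Type*} [NormedAddCommGroup E] [InnerProductSpace ℂ E]
    {T : E →L[ℂ] E} {x : E} {A : ℝ → 𝒜} (hA : Continuous A)
    {φ : 𝒜 →L[ℂ] ℂ}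
    (hmom : ∀ m : ℕ, inner ℂ x ((T ^ m) x) = ∫ t in (0 : ℝ)..2 * Real.pi, φ (A t ^ m)) (q : ℝ[X]) :
    inner ℂ x (aeval T q x) = ∫ t in (0 : ℝ)..2 * Real.pi, φ (aeval (A t) q) := by
  induction q using Polynomial.induction_on' with
  | add p q hp hq =>
    simp only [map_add, _root_.add_apply, inner_add_right, hp, hq]
    rw [intervalIntegral.integral_add]
    · exact (φ.continuous.comp (continuous_aeval_comp hA p)).intervalIntegrable _ _
    · exact (φ.continuous.comp (continuous_aeval_comp hA q)).intervalIntegrable _ _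
  | monomial n c =>
    have h : ∀ y : 𝒜, φ ((algebraMap ℝ 𝒜) c * y) = (c : ℂ) * φ y := fun y => by
      rw [← Algebra.smul_def, ← Complex.coe_smul, map_smul, smul_eq_mul]
    have h' : aeval T (monomial n c) = (c : ℂ) • T ^ n := by
      rw [aeval_monomial, ← Algebra.smul_def, Complex.coe_smul]
    simp only [aeval_monomial, h]
    rw [intervalIntegral.integral_const_mul, ← hmom, ← aeval_monomial, h',
      _root_.smul_apply, inner_smul_right]

theorem norm_aeval_le {a : 𝒜} (ha : IsSelfAdjoint a) (q : ℝ[X]) {c : ℝ} (hc : 0 ≤ c)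
    (h : ∀ l ∈ spectrum ℝ a, |q.eval l| ≤ c) : ‖aeval a q‖ ≤ c := by
  rw [← cfc_polynomial q a ha]
  exact norm_cfc_le hc h

/-- Let the moments of `T` at `x` be averages of functionals of a continuous family `A θ` such
that for almost all `θ` the spectrum of `A θ` avoids a given null set. Then the spectral projection
of that null set annihilates `x`. -/
theorem tendsto_cfc_bump_of_moments [Nontrivial 𝒜] {T : E →L[ℂ] E} (hT : IsSelfAdjoint T)
    {x : E} {A : ℝ → 𝒜} (hA : Continuous A) (hsa : ∀ t, IsSelfAdjoint (A t)) {φ : 𝒜 →L[ℂ] ℂ}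
    (hmom : ∀ m : ℕ, inner ℂ x ((T ^ m) x) = ∫ t in (0 : ℝ)..2 * Real.pi, φ (A t ^ m))
    {K : Set ℝ} (hKne : K.Nonempty) (hK : IsClosed K)
    (hspec : ∀ᵐ t : ℝ, ∀ l ∈ K, l ∉ spectrum ℝ (A t)) :
    Tendsto (fun m => cfc (bump K m) T x) atTop (𝓝 0) := by
  have hpi : (0 : ℝ) ≤ 2 * Real.pi := by positivity
  obtain ⟨R₀, hR₀⟩ := (isCompact_Icc (a := (0 : ℝ)) (b := 2 * Real.pi)).exists_bound_of_continuousOn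
    hA.continuousOn
  -- One interval holds the spectra of `T` and of all `A t` with `t ∈ [0, 2π]`, so the same
  -- polynomials approximate the squared bumps for all of them. The factor `‖1‖` covers a trivial
  -- `E`.
  set R := max R₀ (‖T‖ * ‖(1 : E →L[ℂ] E)‖)
  have hRT : ∀ l ∈ spectrum ℝ T, l ∈ Set.Icc (-R) R := fun l hl =>
    abs_le.1 ((spectrum.norm_le_norm_mul_of_mem hl).trans (le_max_right _ _))
  have hRA : ∀ t ∈ Set.Icc 0 (2 * Real.pi), ∀ l ∈ spectrum ℝ (A t), l ∈ Set.Icc (-R) R :=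
    fun t ht l hl => abs_le.1
      ((spectrum.norm_le_norm_of_mem hl).trans ((hR₀ t ht).trans (le_max_left _ _)))
  have hq : ∀ m : ℕ, ∃ q : ℝ[X], ∀ l ∈ Set.Icc (-R) R,
      |q.eval l - bump K m l ^ 2| < 1 / ((m : ℝ) + 1) := fun m =>
    exists_polynomial_near_of_continuousOn _ _ _ ((continuous_bump K m).pow 2).continuousOn _
      (by positivity)
  choose q hq using hq
  -- Dominated convergence: the bound `2` is the squared bump plus an approximation error of at most
  -- `1`.
  have hlim : Tendsto (fun m : ℕ => ∫ t in (0 : ℝ)..2 * Real.pi, ‖aeval (A t) (q m)‖) atTop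
      (𝓝 (∫ t in (0 : ℝ)..2 * Real.pi, (0 : ℝ))) := by
    refine intervalIntegral.tendsto_integral_filter_of_dominated_convergence (fun _ => 2)
      (Eventually.of_forall fun m =>
        (continuous_aeval_comp hA (q m)).norm.aestronglyMeasurable)
      (Eventually.of_forall fun m => Eventually.of_forall fun t ht => ?_)
      intervalIntegrable_const ?_
    · rw [Set.uIoc_of_le hpi] at ht
      rw [norm_norm]
      refine norm_aeval_le (hsa t) _ zero_le_two fun l hl => ?_
      have h1 := hq m l (hRA t (Set.Ioc_subset_Icc_self ht) l hl)
      have h2 : 1 / ((m : ℝ) + 1) ≤ 1 := by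
        rw [div_le_one (by positivity)]; exact le_add_of_nonneg_left m.cast_nonneg
      have h3 : bump K m l ^ 2 ≤ 1 := pow_le_one₀ (bump_nonneg K m l) (bump_le_one K m l)
      have h4 := sq_nonneg (bump K m l)
      rw [abs_lt] at h1
      rw [abs_le]
      constructor <;> linarith
    · filter_upwards [hspec] with t hspt ht
      rw [Set.uIoc_of_le hpi] at ht
      have hc : IsCompact (spectrum ℝ (A t)) :=
        ContinuousFunctionalCalculus.isCompact_spectrum (A t)
      -- For almost every `t` the compact spectrum of `A t` has positive distance `δ` from `K`, so
      -- the bump vanishes on it once `m ≥ 1 / δ`; only the approximation error remains.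
      obtain ⟨δ, hδ, hδK⟩ : ∃ δ > 0, ∀ l ∈ spectrum ℝ (A t), δ ≤ Metric.infDist l K := by
        rcases (spectrum ℝ (A t)).eq_empty_or_nonempty with he | hne
        · exact ⟨1, one_pos, by simp [he]⟩
        · obtain ⟨l₀, hl₀, hmin⟩ :=
            hc.exists_isMinOn hne (Metric.continuous_infDist_pt K).continuousOn
          exact ⟨_, (hK.notMem_iff_infDist_pos hKne).1 fun h => hspt l₀ h hl₀, fun l hl => hmin hl⟩
      obtain ⟨M, hM⟩ := exists_nat_gt δ⁻¹
      refine squeeze_zero' (Eventually.of_forall fun m => norm_nonneg _) ?_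
        tendsto_one_div_add_atTop_nhds_zero_nat
      filter_upwards [eventually_ge_atTop M] with m hm
      refine norm_aeval_le (hsa t) _ (by positivity) fun l hl => ?_
      have h1 := hq m l (hRA t (Set.Ioc_subset_Icc_self ht) l hl)
      have h2 : bump K m l = 0 := bump_eq_zero (by
        have hMm : (M : ℝ) ≤ m := Nat.cast_le.2 hm
        calc (1 : ℝ) = δ⁻¹ * δ := (inv_mul_cancel₀ hδ.ne').symm
          _ ≤ (m + 1) * Metric.infDist l K :=
            mul_le_mul (by linarith) (hδK l hl) hδ.le (by positivity))
      rw [h2] at h1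
      simpa using h1.le
  rw [intervalIntegral.integral_zero] at hlim
  have hbound : ∀ m : ℕ, ‖cfc (bump K m) T x‖ ^ 2 ≤ 1 / ((m : ℝ) + 1) * ‖x‖ ^ 2
      + ‖φ‖ * ∫ t in (0 : ℝ)..2 * Real.pi, ‖aeval (A t) (q m)‖ := fun m => by
    have h1 : ‖cfc (fun t => bump K m t ^ 2) T - aeval T (q m)‖ ≤ 1 / ((m : ℝ) + 1) := by
      rw [← cfc_polynomial (q m) T hT, ← cfc_sub (fun t => bump K m t ^ 2) _ _
        ((continuous_bump K m).pow 2).continuousOn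
        (q m).continuous.continuousOn]
      refine norm_cfc_le (by positivity) fun l hl => ?_
      rw [norm_sub_rev]
      exact (hq m l (hRT l hl)).le
    have h2 : ‖inner ℂ x ((cfc (fun t => bump K m t ^ 2) T - aeval T (q m)) x)‖
        ≤ 1 / ((m : ℝ) + 1) * ‖x‖ ^ 2 := by
      refine (norm_inner_le_norm _ _).trans ?_
      have := (cfc (fun t => bump K m t ^ 2) T - aeval T (q m)).le_of_opNorm_le h1 x
      nlinarith [norm_nonneg x]
    have h3 : ‖inner ℂ x (aeval T (q m) x)‖
        ≤ ‖φ‖ * ∫ t in (0 : ℝ)..2 * Real.pi, ‖aeval (A t) (q m)‖ := by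
      rw [inner_aeval_eq_integral hA hmom, ← intervalIntegral.integral_const_mul]
      refine (intervalIntegral.norm_integral_le_integral_norm hpi).trans ?_
      have hc := continuous_aeval_comp hA (q m)
      exact intervalIntegral.integral_mono_on hpi
        ((φ.continuous.comp hc).norm.intervalIntegrable _ _)
        ((continuous_const.mul hc.norm).intervalIntegrable _ _) fun t _ => φ.le_opNorm _
    have h4 : ‖cfc (bump K m) T x‖ ^ 2 = ‖inner ℂ x (cfc (fun t => bump K m t ^ 2) T x)‖ := by
      rw [inner_cfc_sq_bump, Complex.norm_real, Real.norm_of_nonneg (by positivity)]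
    have h5 : cfc (fun t => bump K m t ^ 2) T x
        = (cfc (fun t => bump K m t ^ 2) T - aeval T (q m)) x + aeval T (q m) x := by simp
    rw [h4, h5, inner_add_right]
    exact (norm_add_le _ _).trans (add_le_add h2 h3)
  have hlim2 : Tendsto (fun m => ‖cfc (bump K m) T x‖ ^ 2) atTop (𝓝 0) := by
    refine squeeze_zero (fun m => by positivity) hbound ?_
    simpa using (tendsto_one_div_add_atTop_nhds_zero_nat.mul_const (‖x‖ ^ 2)).add
      (hlim.const_mul ‖φ‖)
  rw [tendsto_zero_iff_norm_tendsto_zero]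
  simpa using hlim2.sqrt

end DirectIntegral

/-! ### The standard basis of `ℓ²(ℤ) ⊕ ℓ²(ℤ)` -/

/-- The standard basis vector of `ℓ²(ℤ) ⊕ ℓ²(ℤ)` with entry `1` at `n`, in the component `i`. -/
noncomputable def basisVec (n : ℤ) (i : Fin 2) : L2Pair :=
  WithLp.toLp 2 (if i = 0 then lp.single 2 n 1 else 0, if i = 1 then lp.single 2 n 1 else 0)

theorem entry_basisVec (n : ℤ) (i : Fin 2) (m : ℤ) (j : Fin 2) :
    entry (basisVec n i) m j = if m = n ∧ j = i then 1 else 0 := by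
  fin_cases i <;> fin_cases j <;> simp [entry, basisVec, Pi.single_apply]

theorem entry_add (x y : L2Pair) (n : ℤ) : entry (x + y) n = entry x n + entry y n := by
  ext i; fin_cases i <;> rfl

theorem entry_smul (c : ℂ) (y : L2Pair) (n : ℤ) : entry (c • y) n = c • entry y n := by
  ext i; fin_cases i <;> rfl

theorem entry_zero (n : ℤ) : entry 0 n = 0 := by
  ext i; fin_cases i <;> rfl

theorem inner_basisVec (n : ℤ) (i : Fin 2) (y : L2Pair) :
    inner ℂ (basisVec n i) y = entry y n i := by
  rw [WithLp.prod_inner_apply]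
  fin_cases i <;> simp [entry, basisVec, lp.inner_single_left]

theorem dense_span_basisVec :
    Dense (Submodule.span ℂ (Set.range fun c : ℤ × Fin 2 => basisVec c.1 c.2) : Set L2Pair) := by
  rw [Submodule.dense_iff_topologicalClosure_eq_top, Submodule.topologicalClosure_eq_top_iff,
    Submodule.eq_bot_iff]
  intro y hy
  refine entry_ext fun n => funext fun i => ?_
  rw [← inner_basisVec, entry_zero]
  exact (Submodule.mem_orthogonal _ _).1 hy _ (Submodule.subset_span ⟨(n, i), rfl⟩)

/-! ### Self-adjointness -/

section Jacobi

variable {a : Matrix (Fin 2) (Fin 2) ℂ} {d : ℤ → Matrix (Fin 2) (Fin 2) ℂ}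
  {hd : ∃ C : ℝ, ∀ n i j, ‖d n i j‖ ≤ C}

theorem entry_jacobi_apply (y : L2Pair) (n : ℤ) (i : Fin 2) :
    entry (jacobi a d hd y) n i = ∑ j, (a i j * entry y (n - 1) j
      + star (a j i) * entry y (n + 1) j + d n i j * entry y n j) := by
  rw [entry_jacobi]
  fin_cases i <;> simp [Finset.sum_add_distrib]

theorem jacobi_basisVec (n : ℤ) (i : Fin 2) :
    jacobi a d hd (basisVec n i) = ∑ j, (a j i • basisVec (n + 1) j
      + star (a i j) • basisVec (n - 1) j + d n j i • basisVec n j) := by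
  refine entry_ext fun m => funext fun l => ?_
  rw [entry_jacobi_apply]
  have h1 : m - 1 = n ↔ m = n + 1 := sub_eq_iff_eq_add
  have h2 : m + 1 = n ↔ m = n - 1 := eq_sub_iff_add_eq.symm
  simp only [Fin.sum_univ_two, entry_add, entry_smul, Pi.add_apply, Pi.smul_apply,
    entry_basisVec, smul_eq_mul, h1, h2]
  rcases eq_or_ne m n with rfl | hm
  · fin_cases l <;> fin_cases i <;> simp
  · fin_cases l <;> fin_cases i <;> simp [hm]

theorem isSelfAdjoint_jacobi (hh : ∀ n, (d n).IsHermitian) : IsSelfAdjoint (jacobi a d hd) := by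
  rw [ContinuousLinearMap.isSelfAdjoint_iff']
  refine ContinuousLinearMap.ext fun y => entry_ext fun n => funext fun i => ?_
  rw [← inner_basisVec, ContinuousLinearMap.adjoint_inner_right, jacobi_basisVec,
    entry_jacobi_apply, sum_inner]
  refine Finset.sum_congr rfl fun j _ => ?_
  simp only [inner_add_left, inner_smul_left, inner_basisVec, starRingEnd_apply, star_star,
    (hh n).apply]
  ring

/-! ### Floquet theory for periodic Jacobi operators -/

section Floquet

variable {p : ℕ}

open scoped Kronecker

/-- The hopping matrix `a ⊗ S` of a period cell, `S` being the cyclic shift. -/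
def cellShift (p : ℕ) (a : Matrix (Fin 2) (Fin 2) ℂ) :
    Matrix (Fin 2 × ZMod p) (Fin 2 × ZMod p) ℂ :=
  a ⊗ₖ Matrix.of fun m n : ZMod p => if m - 1 = n then 1 else 0

/-- The Floquet matrix at the quasimomentum `t` of a Jacobi operator with period `p`. -/
noncomputable def floquet (p : ℕ) (a : Matrix (Fin 2) (Fin 2) ℂ)
    (d : ℤ → Matrix (Fin 2) (Fin 2) ℂ) (t : ℝ) : Matrix (Fin 2 × ZMod p) (Fin 2 × ZMod p) ℂ :=
  Complex.exp (-(t * Complex.I)) • cellShift p a + Complex.exp (t * Complex.I) • (cellShift p a)ᴴ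
    + Matrix.blockDiagonal fun m : ZMod p => d m.cast

theorem isHermitian_floquet (hh : ∀ n, (d n).IsHermitian) (t : ℝ) :
    (floquet p a d t).IsHermitian := by
  have h1 : star (Complex.exp (-(t * Complex.I))) = Complex.exp (t * Complex.I) := by
    rw [← starRingEnd_apply, ← Complex.exp_conj]; simp
  have h2 : star (Complex.exp (t * Complex.I)) = Complex.exp (-(t * Complex.I)) := by
    rw [← h1, star_star]
  have h3 : (fun m : ZMod p => (d m.cast)ᴴ) = fun m => d m.cast := funext fun m => hh _
  simp only [Matrix.IsHermitian, floquet, Matrix.conjTranspose_add, Matrix.conjTranspose_smul,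
    Matrix.conjTranspose_conjTranspose, Matrix.blockDiagonal_conjTranspose, h1, h2, h3]
  abel

theorem continuous_floquet : Continuous (floquet p a d) := by
  unfold floquet
  fun_prop

variable [NeZero p]

/-- The cyclic shift is a permutation matrix, so the Kronecker determinant is a power of `a.det` up
to sign. -/
theorem det_cellShift_ne_zero (ha : a.det ≠ 0) : (cellShift p a).det ≠ 0 := by
  have h : (Matrix.of fun m n : ZMod p => if m - 1 = n then (1 : ℂ) else 0)
      = Equiv.Perm.permMatrix ℂ (Equiv.subRight (1 : ZMod p)) := by
    ext m n
    simp [Equiv.Perm.permMatrix, PEquiv.toMatrix_apply, eq_comm]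
  rw [cellShift, h, Matrix.det_kronecker, Matrix.det_permutation]
  refine mul_ne_zero (pow_ne_zero _ ha) (pow_ne_zero _ ?_)
  exact_mod_cast (Equiv.Perm.sign _).ne_zero

/-- On integer representatives the Floquet matrix acts by the Jacobi expression with a phase
`e^{∓it}` on each hop. For `p ≤ 2` the neighbours coincide modulo `p`, and their contributions add
up. -/
theorem floquet_mul_apply (hper : ∀ n, d (n + p) = d n)
    (X : Matrix (Fin 2 × ZMod p) (Fin 2 × ZMod p) ℂ) (t : ℝ) (i : Fin 2) (n : ℤ)
    (c : Fin 2 × ZMod p) :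
    (floquet p a d t * X) (i, (n : ZMod p)) c
      = ∑ j, (a i j * (Complex.exp (-(t * Complex.I)) * X (j, ((n - 1 : ℤ) : ZMod p)) c)
        + star (a j i) * (Complex.exp (t * Complex.I) * X (j, ((n + 1 : ℤ) : ZMod p)) c)
        + d n i j * X (j, (n : ZMod p)) c) := by
  -- `ZMod.cast` picks the remainder of `n` modulo `p`; periodicity restores `d n`.
  have hdn : d ((n : ZMod p).cast : ℤ) = d n := by
    have h : Function.Periodic d (p : ℤ) := hper
    rw [ZMod.coe_intCast, Int.emod_def, mul_comm]
    exact (h.int_mul _).sub_eq n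
  have hsub : ∀ m : ZMod p, (m - 1 = (n : ZMod p)) ↔ m = n + 1 := fun m => sub_eq_iff_eq_add
  simp only [Matrix.mul_apply, Fintype.sum_prod_type]
  refine Finset.sum_congr rfl fun j _ => ?_
  simp [floquet, cellShift, Matrix.blockDiagonal_apply, add_mul, Finset.sum_add_distrib, hdn,
    hsub, apply_ite star]
  ring

theorem integral_exp_int_mul (k : ℤ) :
    ∫ t in (0 : ℝ)..2 * Real.pi, Complex.exp (k * (t * Complex.I))
      = if k = 0 then 2 * (Real.pi : ℂ) else 0 := by
  split_ifs with hk
  · simp [hk]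
  · have h : ∀ t : ℝ, (k : ℂ) * (t * Complex.I) = (k * Complex.I) * t := fun t => by ring
    simp only [h]
    rw [integral_exp_mul_complex (mul_ne_zero (Int.cast_ne_zero.2 hk) Complex.I_ne_zero)]
    have h2 : (k : ℂ) * Complex.I * ((2 * Real.pi : ℝ) : ℂ) = k * (2 * Real.pi * Complex.I) := by
      push_cast; ring
    rw [h2, Complex.exp_int_mul_two_pi_mul_I]
    simp

/-- Both sides satisfy the same recursion in `m`: the factor `e^{i(n - n₀)t}` absorbs the phase of a
hop by moving `n` one site. At `m = 0`, integration removes the sites `n ≠ n₀` that are congruent to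
`n₀` modulo `p`. -/
theorem entry_jacobi_pow_basisVec (hper : ∀ n, d (n + p) = d n) (n₀ : ℤ) (i₀ : Fin 2) (m : ℕ)
    (n : ℤ) (i : Fin 2) :
    entry ((jacobi a d hd ^ m) (basisVec n₀ i₀)) n i
      = ∫ t in (0 : ℝ)..2 * Real.pi, (2 * Real.pi : ℂ)⁻¹ *
        (Complex.exp (((n - n₀ : ℤ) : ℂ) * (t * Complex.I)) *
          (floquet p a d t ^ m) (i, (n : ZMod p)) (i₀, (n₀ : ZMod p))) := by
  induction m generalizing n i with
  | zero =>
    simp only [pow_zero, one_apply_eq_self, entry_basisVec,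
      intervalIntegral.integral_const_mul, intervalIntegral.integral_mul_const,
      integral_exp_int_mul, sub_eq_zero]
    by_cases hn : n = n₀
    · by_cases hi : i = i₀ <;> simp [hn, hi, Matrix.one_apply]
      field
    · simp [hn]
  | succ m ih =>
    have hX : Continuous fun t => floquet p a d t ^ m := continuous_floquet.pow m
    have hc : ∀ (n : ℤ) (i : Fin 2), IntervalIntegrable (fun t : ℝ => (2 * Real.pi : ℂ)⁻¹ *
        (Complex.exp (((n - n₀ : ℤ) : ℂ) * (t * Complex.I)) *
          (floquet p a d t ^ m) (i, (n : ZMod p)) (i₀, (n₀ : ZMod p)))) volume 0 (2 * Real.pi) :=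
      fun n i => by
        have := hX.matrix_elem (i, (n : ZMod p)) (i₀, (n₀ : ZMod p))
        exact Continuous.intervalIntegrable (by fun_prop) _ _
    rw [pow_succ', mul_apply_eq_comp, entry_jacobi_apply]
    simp only [ih, ← intervalIntegral.integral_const_mul]
    have hs : ∀ j, IntervalIntegrable (fun t : ℝ => _) volume 0 (2 * Real.pi) := fun j =>
      (((hc (n - 1) j).const_mul (a i j)).add ((hc (n + 1) j).const_mul (star (a j i)))).add
        ((hc n j).const_mul (d n i j))
    rw [Finset.sum_congr rfl fun j _ => by
      rw [← intervalIntegral.integral_add ((hc (n - 1) j).const_mul (a i j))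
          ((hc (n + 1) j).const_mul (star (a j i))),
        ← intervalIntegral.integral_add (((hc (n - 1) j).const_mul (a i j)).add
          ((hc (n + 1) j).const_mul (star (a j i)))) ((hc n j).const_mul (d n i j))]]
    rw [← intervalIntegral.integral_finsetSum fun j _ => hs j]
    refine intervalIntegral.integral_congr fun t _ => ?_
    have h1 : Complex.exp (((n - 1 - n₀ : ℤ) : ℂ) * (t * Complex.I))
        = Complex.exp (((n - n₀ : ℤ) : ℂ) * (t * Complex.I)) * Complex.exp (-(t * Complex.I)) := by
      rw [← Complex.exp_add]; push_cast; ring_nf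
    have h2 : Complex.exp (((n + 1 - n₀ : ℤ) : ℂ) * (t * Complex.I))
        = Complex.exp (((n - n₀ : ℤ) : ℂ) * (t * Complex.I)) * Complex.exp (t * Complex.I) := by
      rw [← Complex.exp_add]; push_cast; ring_nf
    simp only [pow_succ', floquet_mul_apply hper, Finset.mul_sum, h1, h2]
    refine Finset.sum_congr rfl fun j _ => ?_
    ring

open scoped Matrix.Norms.L2Operator

theorem ae_notMem_spectrum_floquet (ha : a.det ≠ 0) {E : Set ℝ} (hE : volume E = 0) :
    ∀ᵐ t : ℝ, ∀ l ∈ E, l ∉ spectrum ℝ (floquet p a d t) := by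
  filter_upwards [ae_forall_det_ne_zero (cellShift p a) (cellShift p a)ᴴ
    (Matrix.blockDiagonal fun m : ZMod p => d m.cast) (det_cellShift_ne_zero ha) hE] with t ht l hl
  rw [spectrum.notMem_iff, ← IsUnit.neg_iff, neg_sub, Matrix.isUnit_iff_isUnit_det,
    isUnit_iff_ne_zero]
  have h : algebraMap ℝ (Matrix (Fin 2 × ZMod p) (Fin 2 × ZMod p) ℂ) l
      = (l : ℂ) • (1 : Matrix (Fin 2 × ZMod p) (Fin 2 × ZMod p) ℂ) := by
    rw [Algebra.algebraMap_eq_smul_one, Complex.coe_smul]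
  rw [h]
  exact ht l hl

theorem hasAbsolutelyContinuousSpectrum_jacobi (hper : ∀ n, d (n + p) = d n)
    (hh : ∀ n, (d n).IsHermitian) (ha : a.det ≠ 0) :
    HasAbsolutelyContinuousSpectrum (jacobi a d hd) := by
  refine hasAbsolutelyContinuousSpectrum_of_dense_span (isSelfAdjoint_jacobi hh)
    dense_span_basisVec fun K hKne hK h0 => ?_
  rintro _ ⟨⟨n, i⟩, rfl⟩
  -- For a diagonal matrix element the exponential factor is `1`, so the moments are averages of one
  -- fixed functional.
  let φ : Matrix (Fin 2 × ZMod p) (Fin 2 × ZMod p) ℂ →L[ℂ] ℂ := LinearMap.toContinuousLinearMap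
    ((2 * Real.pi : ℂ)⁻¹ • Matrix.entryLinearMap ℂ ℂ (i, (n : ZMod p)) (i, (n : ZMod p)))
  refine tendsto_cfc_bump_of_moments (isSelfAdjoint_jacobi hh) (continuous_floquet (p := p))
    (fun t => isHermitian_floquet hh t) (φ := φ) (fun m => ?_) hKne hK.isClosed
    (ae_notMem_spectrum_floquet ha h0)
  rw [inner_basisVec, entry_jacobi_pow_basisVec hper]
  refine intervalIntegral.integral_congr fun t _ => ?_
  simp [φ]

end Floquet

end Jacobi

/-! ### The coefficients of the nanotube -/

theorem isHermitian_diag (b₃ : ℝ) (v : ℤ → ℝ) (n : ℤ) : (diag b₃ v n).IsHermitian := by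
  ext i j
  fin_cases i <;> fin_cases j <;> simp [diag, ← Complex.exp_conj]

theorem det_offDiag_ne_zero (N : ℕ) (b₁ b₂ : ℝ) (k : ℕ) : (offDiag N b₁ b₂ k).det ≠ 0 := by
  simp [offDiag, Matrix.det_fin_two, Complex.exp_ne_zero]

/-- Shifting `n` by `p` moves the potential by two periods, so `p` is a period of `d` whatever its
parity. -/
theorem diag_add_period {v : ℤ → ℝ} {p : ℕ} (hv : ∀ n : ℤ, v (n + p) = v n) (b₃ : ℝ) (n : ℤ) :
    diag b₃ v (n + p) = diag b₃ v n := by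
  have h1 : v (2 * (n + p)) = v (2 * n) := by
    rw [show 2 * (n + p : ℤ) = 2 * n + p + p by ring, hv, hv]
  have h2 : v (2 * (n + p) + 1) = v (2 * n + 1) := by
    rw [show 2 * (n + p : ℤ) + 1 = 2 * n + 1 + p + p by ring, hv, hv]
  simp [diag, h1, h2]

/-! ### Slices of functions on a product with a finite set -/

section Slice

variable {ι C : Type*}

theorem summable_norm_sq (f : L2 ι) : Summable fun i => ‖f i‖ ^ 2 := by
  simpa using (lp.memℓp f).summable (by norm_num)

theorem norm_sq_eq_tsum (f : L2 ι) : ‖f‖ ^ 2 = ∑' i, ‖f i‖ ^ 2 := by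
  simpa using lp.norm_rpow_eq_tsum (p := 2) (by norm_num) f

/-- The restriction of a function on `ι × C` to `ι × {c}`. -/
def slice (c : C) : L2 (ι × C) →ₗ[ℂ] L2 ι where
  toFun f := ⟨fun i => f (i, c), by
    apply memℓp_gen
    simpa [Function.comp_def] using
      (summable_norm_sq f).comp_injective (Prod.mk_left_injective c)⟩
  map_add' _ _ := rfl
  map_smul' _ _ := rfl

theorem norm_sq_eq_sum_slice [Fintype C] (f : L2 (ι × C)) : ‖f‖ ^ 2 = ∑ c, ‖slice c f‖ ^ 2 := by
  calc ‖f‖ ^ 2 = ∑' i, ∑' c, ‖f (i, c)‖ ^ 2 := by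
        rw [norm_sq_eq_tsum, (summable_norm_sq f).tsum_prod]
    _ = ∑' i, ∑ c, ‖slice c f i‖ ^ 2 := tsum_congr fun i => tsum_fintype _
    _ = ∑ c, ∑' i, ‖slice c f i‖ ^ 2 :=
        Summable.tsum_finsetSum fun c _ => summable_norm_sq (slice c f)
    _ = ∑ c, ‖slice c f‖ ^ 2 := Finset.sum_congr rfl fun c _ => (norm_sq_eq_tsum _).symm

theorem exists_slice_eq [Finite C] (y : C → L2 ι) : ∃ f : L2 (ι × C), ∀ c, slice c f = y c := by
  have := Fintype.ofFinite C
  refine ⟨⟨fun z => y z.2 z.1, ?_⟩, fun c => rfl⟩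
  apply memℓp_gen
  have h : Summable fun z : ι × C => ‖y z.2 z.1‖ ^ 2 := by
    rw [summable_prod_of_nonneg fun z => by positivity]
    refine ⟨fun i => (hasSum_fintype _).summable, ?_⟩
    simp only [tsum_fintype]
    exact summable_sum fun c _ => summable_norm_sq (y c)
  simpa using h

end Slice

/-! ### The discrete Fourier transform -/

/-- Parseval with vector coefficients: expanding the squares leaves the Gram matrix of the columns
of `F`. -/
theorem sum_norm_sq_sum_smul {κ G E : Type*} [Fintype κ] [Fintype G] [DecidableEq G]
    [NormedAddCommGroup E] [InnerProductSpace ℂ E] {F : Matrix κ G ℂ} (hF : Fᴴ * F = 1)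
    (x : G → E) : ∑ k, ‖∑ j, F k j • x j‖ ^ 2 = ∑ j, ‖x j‖ ^ 2 := by
  have hn : ∀ y : E, ((‖y‖ ^ 2 : ℝ) : ℂ) = inner ℂ y y := fun y => by
    rw [Complex.ofReal_pow]; exact (inner_self_eq_norm_sq_to_K y).symm
  have hFe : ∀ i j, ∑ k, star (F k i) * F k j = if i = j then 1 else 0 := fun i j => by
    have := congrFun (congrFun hF i) j
    rwa [Matrix.mul_apply, Matrix.one_apply] at this
  apply Complex.ofReal_injective
  simp only [Complex.ofReal_sum, hn, sum_inner, inner_sum, inner_smul_left, inner_smul_right]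
  rw [Finset.sum_comm]
  refine Finset.sum_congr rfl fun i _ => ?_
  calc ∑ k, F k i * ∑ j, starRingEnd ℂ (F k j) * inner ℂ (x j) (x i)
      = ∑ k, ∑ j, star (F k j) * F k i * inner ℂ (x j) (x i) := by
        simp_rw [Finset.mul_sum, ← mul_assoc, starRingEnd_apply, mul_comm (F _ i)]
    _ = ∑ j, (∑ k, star (F k j) * F k i) * inner ℂ (x j) (x i) := by
        rw [Finset.sum_comm]
        simp_rw [Finset.sum_mul]
    _ = inner ℂ (x i) (x i) := by
        simp only [hFe]
        simp

/-- The matrix of the unitary discrete Fourier transform. -/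
noncomputable def dftMatrix (N : ℕ) [NeZero N] : Matrix (Finset.Icc 1 N) (ZMod N) ℂ :=
  fun k j => (Real.sqrt N : ℂ)⁻¹ * ZMod.stdAddChar (((k : ℕ) : ZMod N) * j)

theorem natCast_injOn_Icc {N k l : ℕ} (hk : k ∈ Finset.Icc 1 N) (hl : l ∈ Finset.Icc 1 N)
    (h : (k : ZMod N) = l) : k = l := by
  rw [Finset.mem_Icc] at hk hl
  rw [ZMod.natCast_eq_natCast_iff] at h
  -- Shifting `1, …, N` to `0, …, N - 1` makes congruence imply equality.
  have h1 : k - 1 ≡ l - 1 [MOD N] := by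
    refine Nat.ModEq.add_right_cancel' 1 ?_
    rwa [Nat.sub_add_cancel hk.1, Nat.sub_add_cancel hl.1]
  have := h1.eq_of_lt_of_lt (by omega) (by omega)
  omega

section Fourier

variable {N : ℕ} [NeZero N]

theorem stdAddChar_natCast (k : ℕ) :
    ZMod.stdAddChar ((k : ℕ) : ZMod N) = Complex.exp (2 * Real.pi * Complex.I / N) ^ k := by
  have h := ZMod.stdAddChar_coe (N := N) (k : ℤ)
  rw [← Complex.exp_nat_mul]
  rw [Int.cast_natCast] at h
  rw [h]
  congr 1
  push_cast
  ring

/-- Additive characters turn translations into scalars; this is the origin of `s ^ k` in `a_k`. -/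
theorem dftMatrix_add_one (k : Finset.Icc 1 N) (j : ZMod N) :
    dftMatrix N k (j + 1)
      = Complex.exp (2 * Real.pi * Complex.I / N) ^ (k : ℕ) * dftMatrix N k j := by
  rw [dftMatrix, mul_add, mul_one, AddChar.map_add_eq_mul, stdAddChar_natCast, dftMatrix]
  ring

theorem star_stdAddChar (x : ZMod N) :
    star (ZMod.stdAddChar x : ℂ) = ZMod.stdAddChar (-x) :=
  (AddChar.map_neg_eq_conj _ x).symm

theorem dftMatrix_sub_one (k : Finset.Icc 1 N) (j : ZMod N) :
    dftMatrix N k (j - 1)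
      = star (Complex.exp (2 * Real.pi * Complex.I / N) ^ (k : ℕ)) * dftMatrix N k j := by
  rw [dftMatrix, mul_sub, mul_one, sub_eq_add_neg, AddChar.map_add_eq_mul, ← star_stdAddChar,
    stdAddChar_natCast, dftMatrix]
  ring

/-- Orthogonality of characters: the sum over `j` vanishes unless `k` and `l` agree modulo `N`, and
`1, …, N` represent each class once. -/
theorem dftMatrix_mul_conjTranspose : dftMatrix N * (dftMatrix N)ᴴ = 1 := by
  ext k l
  have hN : (N : ℂ) ≠ 0 := Nat.cast_ne_zero.2 (NeZero.ne N)
  have hsq : (Real.sqrt N : ℂ)⁻¹ * (Real.sqrt N : ℂ)⁻¹ = (N : ℂ)⁻¹ := by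
    rw [← mul_inv, ← Complex.ofReal_mul, Real.mul_self_sqrt (Nat.cast_nonneg N),
      Complex.ofReal_natCast]
  have hterm : ∀ j, dftMatrix N k j * star (dftMatrix N l j) = (N : ℂ)⁻¹ *
      ZMod.stdAddChar (j * (((k : ℕ) : ZMod N) - ((l : ℕ) : ZMod N))) := fun j => by
    rw [dftMatrix, dftMatrix, star_mul, star_stdAddChar, mul_sub, sub_eq_add_neg,
      AddChar.map_add_eq_mul, ← hsq, star_inv₀, ← starRingEnd_apply, Complex.conj_ofReal,
      mul_comm j, mul_comm j]
    ring
  simp only [Matrix.mul_apply, Matrix.conjTranspose_apply, hterm, ← Finset.mul_sum]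
  rw [AddChar.sum_mulShift _ (ZMod.isPrimitive_stdAddChar N), Matrix.one_apply, ZMod.card]
  by_cases hkl : k = l
  · simp [hkl, hN]
  · rw [if_neg hkl, if_neg, Nat.cast_zero, mul_zero]
    exact fun h => hkl (Subtype.ext (natCast_injOn_Icc k.2 l.2 (sub_eq_zero.1 h)))

theorem dftMatrix_conjTranspose_mul : (dftMatrix N)ᴴ * dftMatrix N = 1 :=
  (Matrix.mul_eq_one_comm_of_card_eq _ _ _ (by simp [ZMod.card])).1 dftMatrix_mul_conjTranspose

/-- The discrete Fourier transform in the angular variable of the nanotube. -/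
noncomputable def angularFourier (N : ℕ) [NeZero N] :
    L2 (Vertex N) →ₗᵢ[ℂ] PiLp 2 fun _ : Finset.Icc 1 N => L2Pair where
  toLinearMap :=
    { toFun := fun f => WithLp.toLp 2 fun k => WithLp.toLp 2
        (∑ j, dftMatrix N k j • slice (ι := ℤ) ((0 : Fin 2), j) f,
          ∑ j, dftMatrix N k j • slice (ι := ℤ) ((1 : Fin 2), j) f)
      map_add' := fun f g => by
        simp only [map_add, smul_add, Finset.sum_add_distrib]
        rfl
      map_smul' := fun c f => by
        simp only [map_smul, smul_comm _ c, ← Finset.smul_sum]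
        rfl }
  norm_map' f := by
    refine (sq_eq_sq₀ (norm_nonneg _) (norm_nonneg _)).1 ?_
    simp only [LinearMap.coe_mk, AddHom.coe_mk, PiLp.norm_sq_eq_of_L2,
      WithLp.prod_norm_sq_eq_of_L2, Finset.sum_add_distrib]
    rw [norm_sq_eq_sum_slice (ι := ℤ) (C := Fin 2 × ZMod N) f, Fintype.sum_prod_type,
      Fin.sum_univ_two]
    exact congrArg₂ (· + ·) (sum_norm_sq_sum_smul dftMatrix_conjTranspose_mul _)
      (sum_norm_sq_sum_smul dftMatrix_conjTranspose_mul _)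

theorem angularFourier_apply (f : L2 (Vertex N)) (k : Finset.Icc 1 N) :
    angularFourier N f k = WithLp.toLp 2
        (∑ j, dftMatrix N k j • slice (ι := ℤ) ((0 : Fin 2), j) f,
          ∑ j, dftMatrix N k j • slice (ι := ℤ) ((1 : Fin 2), j) f) := rfl

theorem entry_angularFourier (f : L2 (Vertex N)) (k : Finset.Icc 1 N) (n : ℤ) (i : Fin 2) :
    entry (angularFourier N f k) n i = ∑ j, dftMatrix N k j * f (n, i, j) := by
  have h : ∀ i : Fin 2, (∑ j, dftMatrix N k j • slice (ι := ℤ) (i, j) f : L2 ℤ) n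
      = ∑ j, dftMatrix N k j * f (n, i, j) := fun i => by
    rw [lp.coeFn_sum, Finset.sum_apply]
    rfl
  fin_cases i
  · exact h 0
  · exact h 1

theorem angularFourier_surjective : Function.Surjective (angularFourier N) := fun g => by
  have hF : ∀ k l, ∑ j, dftMatrix N k j * star (dftMatrix N l j) = if k = l then 1 else 0 :=
    fun k l => by
      have := congrFun (congrFun (dftMatrix_mul_conjTranspose (N := N)) k) l
      rwa [Matrix.mul_apply, Matrix.one_apply] at this
  have hinv : ∀ (x : Finset.Icc 1 N → L2 ℤ) k,
      ∑ j, dftMatrix N k j • ∑ l, star (dftMatrix N l j) • x l = x k := fun x k => by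
    simp only [Finset.smul_sum, smul_smul]
    rw [Finset.sum_comm]
    simp only [← Finset.sum_smul, hF, ite_smul, one_smul, zero_smul]
    simp
  -- The preimage is given by the inverse transform, whose matrix is the conjugate transpose.
  obtain ⟨f, hf⟩ := exists_slice_eq (ι := ℤ) (C := Fin 2 × ZMod N) fun c =>
    ∑ l, star (dftMatrix N l c.2) • (if c.1 = 0 then (g l).fst else (g l).snd)
  refine ⟨f, PiLp.ext fun k => ?_⟩
  rw [angularFourier_apply]
  simp only [hf, if_true, one_ne_zero, if_false, hinv]
  rfl

/-- Only the `b₁` bonds change the angular index. Reindexing the Fourier sum gives them the factor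
`s ^ k` or its conjugate, as in `a_k` and its adjoint; all other terms pass through unchanged. -/
theorem angularFourier_hamiltonian (b₁ b₂ b₃ : ℝ) (v : Potential) (f : L2 (Vertex N))
    (k : Finset.Icc 1 N) :
    angularFourier N (hamiltonian N b₁ b₂ b₃ v f) k
      = armchairJacobi N b₁ b₂ b₃ v k (angularFourier N f k) := by
  have hsub : ∀ g : ZMod N → ℂ, ∑ j, dftMatrix N k j * g (j - 1)
      = Complex.exp (2 * Real.pi * Complex.I / N) ^ (k : ℕ) * ∑ j, dftMatrix N k j * g j :=
    fun g => by
      rw [← Equiv.sum_comp (Equiv.addRight (1 : ZMod N)), Finset.mul_sum]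
      refine Finset.sum_congr rfl fun j _ => ?_
      simp only [Equiv.coe_addRight, dftMatrix_add_one, add_sub_cancel_right, mul_assoc]
  have hadd : ∀ g : ZMod N → ℂ, ∑ j, dftMatrix N k j * g (j + 1)
      = star (Complex.exp (2 * Real.pi * Complex.I / N) ^ (k : ℕ))
        * ∑ j, dftMatrix N k j * g j := fun g => by
      rw [← Equiv.sum_comp (Equiv.subRight (1 : ZMod N)), Finset.mul_sum]
      refine Finset.sum_congr rfl fun j _ => ?_
      simp only [Equiv.subRight_apply, dftMatrix_sub_one, sub_add_cancel, mul_assoc]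
  have hexp : ∀ b : ℝ, star (Complex.exp (Complex.I * b)) = Complex.exp (-(Complex.I * b)) :=
    fun b => by rw [← starRingEnd_apply, ← Complex.exp_conj]; simp
  have hexp' : ∀ b : ℝ, star (Complex.exp (-(Complex.I * b))) = Complex.exp (Complex.I * b) :=
    fun b => by rw [← hexp, star_star]
  refine entry_ext fun n => funext fun i => ?_
  rw [armchairJacobi, entry_jacobi_apply]
  simp only [entry_angularFourier, hamiltonian_apply, Fin.sum_univ_two]
  fin_cases i
  · have h : ∀ j, dftMatrix N k j * hamiltonianFormula b₁ b₂ b₃ v f (n, 0, j)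
        = Complex.exp (Complex.I * b₂) * (dftMatrix N k j * f (n + 1, 1, j))
          + Complex.exp (Complex.I * b₁) * (dftMatrix N k j * f (n - 1, 1, j - 1))
          + Complex.exp (Complex.I * b₃) * (dftMatrix N k j * f (n, 1, j))
          + v (2 * n) * (dftMatrix N k j * f (n, 0, j)) := fun j => by
      simp only [hamiltonianFormula]; ring
    have h1 := hsub fun j => f (n - 1, 1, j)
    simp only [Fin.zero_eta, h, Finset.sum_add_distrib, ← Finset.mul_sum, h1]
    simp [offDiag, diag, hexp', -Complex.star_def]
    ring
  · have h : ∀ j, dftMatrix N k j * hamiltonianFormula b₁ b₂ b₃ v f (n, 1, j)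
        = Complex.exp (-(Complex.I * b₁)) * (dftMatrix N k j * f (n + 1, 0, j + 1))
          + Complex.exp (-(Complex.I * b₂)) * (dftMatrix N k j * f (n - 1, 0, j))
          + Complex.exp (-(Complex.I * b₃)) * (dftMatrix N k j * f (n, 0, j))
          + v (2 * n + 1) * (dftMatrix N k j * f (n, 1, j)) := fun j => by
      simp only [hamiltonianFormula]; ring
    have h1 := hadd fun j => f (n + 1, 0, j)
    simp only [Fin.mk_one, h, Finset.sum_add_distrib, ← Finset.mul_sum, h1]
    simp [offDiag, diag, hexp, -Complex.star_def]
    ring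

theorem unitarilyEquivalent_hamiltonian (b₁ b₂ b₃ : ℝ) (v : Potential) :
    UnitarilyEquivalent (hamiltonian N b₁ b₂ b₃ v)
      (orthogonalSum fun k : Finset.Icc 1 N => armchairJacobi N b₁ b₂ b₃ v (k : ℕ)) :=
  ⟨LinearIsometryEquiv.ofSurjective (angularFourier N) angularFourier_surjective, fun f =>
    PiLp.ext fun k => angularFourier_hamiltonian b₁ b₂ b₃ v f k⟩

end Fourier

end ArmchairNanotube

theorem theorem5p1 (N : ℕ) (hN : 1 ≤ N) (b₁ b₂ b₃ : ℝ) (v : ArmchairNanotube.Potential) :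
    ArmchairNanotube.UnitarilyEquivalent (ArmchairNanotube.hamiltonian N b₁ b₂ b₃ v)
      (ArmchairNanotube.orthogonalSum fun k : Finset.Icc 1 N =>
        ArmchairNanotube.armchairJacobi N b₁ b₂ b₃ v (k : ℕ)) ∧
    ((∃ p : ℕ, 0 < p ∧ ∀ n : ℤ, v (n + p) = v n) →
      ∀ k ∈ Finset.Icc 1 N, ArmchairNanotube.HasAbsolutelyContinuousSpectrum
        (ArmchairNanotube.armchairJacobi N b₁ b₂ b₃ v k)) := by
  have : NeZero N := ⟨by omega⟩
  refine ⟨ArmchairNanotube.unitarilyEquivalent_hamiltonian b₁ b₂ b₃ v, ?_⟩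
  rintro ⟨p, hp, hv⟩ k -
  have : NeZero p := ⟨hp.ne'⟩
  exact ArmchairNanotube.hasAbsolutelyContinuousSpectrum_jacobi
    (ArmchairNanotube.diag_add_period hv b₃) (ArmchairNanotube.isHermitian_diag b₃ v)
    (ArmchairNanotube.det_offDiag_ne_zero N b₁ b₂ k)
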